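/- Let $G$ be a finite-dimensional real Lie group with identity $e$, equipped with a smooth bi-invariant (that is, left- and right-invariant) pseudo-Riemannian metric $g$; in particular $g$ may be a bi-invariant Riemannian metric. Let $D=G\times G$ carry the product metric $g\oplus g=\mathrm{pr}_1^*g+\mathrm{pr}_2^*g$. Let $\tau(x,y)=(y,x)$ be the twist automorphism of $D$, and let $\mathcal O_{(e,e)}=\{a\,\tau(a)^{-1} : a\in D\}$ be the twisted conjugacy class of the identity, i.e. the orbit of $(e,e)$ under the twisted adjoint action $\mathrm{Ad}_\tau(x,y)\cdot(x_0,y_0)=(x x_0 y^{-1},\,y y_0 x^{-1})$. Then $\mathcal O_{(e,e)}$ is the anti-diagonal $\{(z,z^{-1}) : z\in G\}$; the map $z\mapsto(z,z^{-1})$ is a smooth embedding of $G$ into $D$ with image $\mathcal O_{(e,e)}$, and the metric that $g\oplus g$ induces on it is nondegenerate. The metric $g\oplus g$ has a Levi-Civita connection, and with respect to it the submanifold $\mathcal O_{(e,e)}$ of $D$ is totally geodesic: its second fundamental form vanishes identically. In particular, it is minimal: its mean curvature vector (the trace of the second fundamental form with respect to the induced metric) vanishes identically. -/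

import Mathlib

open Bundle Filter Topology
open scoped Manifold ContDiff

section TwistedConjugacy

variable {G : Type*} [Group G]

/-- The twist `τ(x, y) = (y, x)` of `G × G`, as a group automorphism. -/
def twist (G : Type*) [Group G] : G × G ≃* G × G := MulEquiv.prodComm

/-- The twisted conjugacy class of `p`: its orbit under the twisted adjoint action
`Ad_τ(a) · p = a p τ(a)⁻¹`, that is `(x, y) · (x₀, y₀) = (x x₀ y⁻¹, y y₀ x⁻¹)`. -/
def twistedConjClass (p : G × G) : Set (G × G) :=
  Set.range fun a : G × G => a * p * (twist G a)⁻¹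

/-- The map `z ↦ (z, z⁻¹)` from `G` to `G × G`. -/
def antiDiagonal (G : Type*) [Group G] (z : G) : G × G := (z, z⁻¹)

end TwistedConjugacy

section Metric

variable {E : Type*} [NormedAddCommGroup E] [NormedSpace ℝ E]
  {H : Type*} [TopologicalSpace H] (I : ModelWithCorners ℝ E H)
  (M : Type*) [TopologicalSpace M] [ChartedSpace H M] [IsManifold I ∞ M]

/-- A smooth pseudo-Riemannian metric on `M` (nondegenerate, of arbitrary signature). -/
structure PseudoRiemannianMetric where
  inner (x : M) : TangentSpace I x →L[ℝ] TangentSpace I x →L[ℝ] ℝ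
  symm (x : M) (v w : TangentSpace I x) : inner x v w = inner x w v
  nondegenerate (x : M) (v : TangentSpace I x) (hv : ∀ w, inner x v w = 0) : v = 0
  contMDiff : ContMDiff I (I.prod 𝓘(ℝ, E →L[ℝ] E →L[ℝ] ℝ)) ∞
    (fun x ↦ TotalSpace.mk' (E →L[ℝ] E →L[ℝ] ℝ)
      (E := fun x : M ↦ TangentSpace I x →L[ℝ] TangentSpace I x →L[ℝ] ℝ) x (inner x))

variable {I M}

/-- A Riemannian metric is a pseudo-Riemannian metric. -/
def Bundle.ContMDiffRiemannianMetric.toPseudoRiemannianMetric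
    (g : ContMDiffRiemannianMetric I ∞ E (fun x : M ↦ TangentSpace I x)) :
    PseudoRiemannianMetric I M where
  inner := g.inner
  symm := g.symm
  nondegenerate x v hv := by
    by_contra h
    exact (g.pos x v h).ne' (hv v)
  contMDiff := g.contMDiff

namespace PseudoRiemannianMetric

variable {E' : Type*} [NormedAddCommGroup E'] [NormedSpace ℝ E']
  {H' : Type*} [TopologicalSpace H'] {J : ModelWithCorners ℝ E' H'}
  {N : Type*} [TopologicalSpace N] [ChartedSpace H' N]

/-- The symmetric bilinear form `(u, v) ↦ g(df u, df v)` on `T_y N`, for a map `f : N → M`. -/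
noncomputable def pullback (g : PseudoRiemannianMetric I M) (J : ModelWithCorners ℝ E' H')
    (f : N → M) (y : N) : TangentSpace J y →L[ℝ] TangentSpace J y →L[ℝ] ℝ :=
  (ContinuousLinearMap.precomp ℝ (mfderiv J I f y)) ∘L (g.inner (f y)) ∘L (mfderiv J I f y)

theorem pullback_apply (g : PseudoRiemannianMetric I M)
    (f : N → M) (y : N) (u v : TangentSpace J y) :
    g.pullback J f y u v = g.inner (f y) (mfderiv J I f y u) (mfderiv J I f y v) := rfl

theorem contMDiffAt_inner (g : PseudoRiemannianMetric I M)
  {f : N → M} {v w : ∀ y : N, TangentSpace I (f y)} {y₀ : N}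
  (hv : ContMDiffAt J I.tangent ∞ (fun y => (⟨f y, v y⟩ : TangentBundle I M)) y₀)
  (hw : ContMDiffAt J I.tangent ∞ (fun y => (⟨f y, w y⟩ : TangentBundle I M)) y₀) :
  ContMDiffAt J 𝓘(ℝ, ℝ) ∞ (fun y => g.inner (f y) (v y) (w y)) y₀ := by
  have hb : ContMDiffAt J I ∞ f y₀ := by
    simp only [contMDiffAt_totalSpace] at hv
    exact hv.1
  have : ContMDiffAt J (I.prod 𝓘(ℝ)) ∞
      (fun m ↦ TotalSpace.mk' ℝ (E := Bundle.Trivial M ℝ) (f m) (g.inner (f m) (v m) (w m))) y₀ := by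
    apply ContMDiffAt.clm_bundle_apply₂ (F₁ := E) (F₂ := E)
    · exact ContMDiffAt.comp y₀ g.contMDiff.contMDiffAt hb
    · exact hv
    · exact hw
  simp only [contMDiffAt_totalSpace] at this
  exact this.2

variable [IsManifold J ∞ N]

theorem contMDiff_of_eval [FiniteDimensional ℝ E]
   (b : ∀ x : M, TangentSpace I x →L[ℝ] TangentSpace I x →L[ℝ] ℝ)
   (h : ∀ (x : M) (v w : ∀ y : M, TangentSpace I y),
     ContMDiffAt I I.tangent ∞ (fun y => (⟨y, v y⟩ : TangentBundle I M)) x →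
     ContMDiffAt I I.tangent ∞ (fun y => (⟨y, w y⟩ : TangentBundle I M)) x →
     ContMDiffAt I 𝓘(ℝ, ℝ) ∞ (fun y => b y (v y) (w y)) x) :
   ContMDiff I (I.prod 𝓘(ℝ, E →L[ℝ] E →L[ℝ] ℝ)) ∞
    (fun x ↦ TotalSpace.mk' (E →L[ℝ] E →L[ℝ] ℝ)
      (E := fun x : M ↦ TangentSpace I x →L[ℝ] TangentSpace I x →L[ℝ] ℝ) x (b x)) := by
  intro x
  rw [contMDiffAt_hom_bundle]
  refine ⟨contMDiffAt_id, ?_⟩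
  dsimp only
  set A := fun y : M => ContinuousLinearMap.inCoordinates E (fun x : M ↦ TangentSpace I x) (E →L[ℝ] ℝ)
    (fun x : M ↦ TangentSpace I x →L[ℝ] ℝ) x y x y (b y) with hA
  let B := Module.finBasis ℝ E
  let l : Fin (Module.finrank ℝ E) → E →L[ℝ] ℝ := fun i =>
    LinearMap.toContinuousLinearMap (B.coord i)
  have key : A = fun y => ∑ i, ∑ j, A y (B i) (B j) • (l i).smulRight (l j) := by
    funext y
    ext u v
    conv_lhs => rw [← B.sum_repr u, ← B.sum_repr v]
    simp only [map_sum, map_smul, sum_apply, smul_apply,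
      ContinuousLinearMap.smulRight_apply, smul_eq_mul, Finset.mul_sum]
    rw [Finset.sum_comm]
    refine Finset.sum_congr rfl fun i _ => Finset.sum_congr rfl fun j _ => ?_
    simp only [l, LinearMap.coe_toContinuousLinearMap', Module.Basis.coord_apply]
    ring
  have hs (i : Fin (Module.finrank ℝ E)) : ContMDiffAt I I.tangent ∞
      (fun y => (⟨y, (trivializationAt E (fun x : M ↦ TangentSpace I x) x).symm y (B i)⟩ :
        TangentBundle I M)) x := by
    have hx := FiberBundle.mem_baseSet_trivializationAt' (F := E)
      (E := fun x : M ↦ TangentSpace I x) x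
    have := FiberBundle.contMDiffAt_extend (k := ∞) I E
      ((trivializationAt E (fun x : M ↦ TangentSpace I x) x).symm x (B i))
    simpa only [FiberBundle.extend, Bundle.Trivialization.apply_mk_symm _ hx] using this
  rw [key]
  refine ContMDiffAt.sum fun i _ => ContMDiffAt.sum fun j _ => ?_
  have h3 : ContMDiffAt I 𝓘(ℝ, ℝ) ∞ (fun y => A y (B i) (B j)) x := by
    refine (h x _ _ (hs i) (hs j)).congr_of_eventuallyEq ?_
    have := (trivializationAt E (fun x : M ↦ TangentSpace I x) x).open_baseSet.mem_nhds
       (FiberBundle.mem_baseSet_trivializationAt' x)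
    filter_upwards [this] with y hy
    rw [hA]; dsimp only
    rw [inCoordinates_apply_eq₂ hy hy (Set.mem_univ _)]
    simp
  exact h3.smul contMDiffAt_const

/-- The product metric `pr₁^* g + pr₂^* h` on `M × N`. -/
noncomputable def prod [FiniteDimensional ℝ E] [FiniteDimensional ℝ E']
    (g : PseudoRiemannianMetric I M) (h : PseudoRiemannianMetric J N) :
    PseudoRiemannianMetric (I.prod J) (M × N) where
  inner p := g.pullback (I.prod J) Prod.fst p + h.pullback (I.prod J) Prod.snd p
  symm p v w := by
    simp only [add_apply, pullback_apply]
    rw [g.symm, h.symm]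
  nondegenerate p v hv := by
    simp only [add_apply, pullback_apply, mfderiv_fst, mfderiv_snd] at hv
    refine Prod.ext (g.nondegenerate p.1 v.1 fun w => ?_) (h.nondegenerate p.2 v.2 fun w => ?_)
    · have h1 : g.inner p.1 v.1 w + h.inner p.2 v.2 0 = 0 := hv ((w, 0) : E × E')
      rwa [map_zero, add_zero] at h1
    · have h1 : g.inner p.1 v.1 0 + h.inner p.2 v.2 w = 0 := hv ((0, w) : E × E')
      rwa [map_zero, zero_add] at h1
  contMDiff := by
    refine contMDiff_of_eval _ fun p v w hv hw => ?_
    simp only [add_apply, pullback_apply]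
    refine ContMDiffAt.add (g.contMDiffAt_inner ?_ ?_) (h.contMDiffAt_inner ?_ ?_)
    · exact (contMDiff_fst.contMDiff_tangentMap (m := ∞) (n := ∞) le_rfl).contMDiffAt.comp p hv
    · exact (contMDiff_fst.contMDiff_tangentMap (m := ∞) (n := ∞) le_rfl).contMDiffAt.comp p hw
    · exact (contMDiff_snd.contMDiff_tangentMap (m := ∞) (n := ∞) le_rfl).contMDiffAt.comp p hv
    · exact (contMDiff_snd.contMDiff_tangentMap (m := ∞) (n := ∞) le_rfl).contMDiffAt.comp p hw

/-- `cov` is a Levi-Civita connection of `g`: it is torsion-free, `∇_X Y - ∇_Y X = [X, Y]`, and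
metric, `u g(X, Y) = g(∇_u X, Y) + g(X, ∇_u Y)`. Here `cov Y x u` is `(∇_u Y)(x)`. -/
structure IsLeviCivita (g : PseudoRiemannianMetric I M)
    (cov : CovariantDerivative I E (fun x : M ↦ TangentSpace I x)) : Prop where
  torsion_free (X Y : ∀ x : M, TangentSpace I x) (x : M)
    (hX : MDifferentiableAt I I.tangent (fun y ↦ (⟨y, X y⟩ : TangentBundle I M)) x)
    (hY : MDifferentiableAt I I.tangent (fun y ↦ (⟨y, Y y⟩ : TangentBundle I M)) x) :
    cov Y x (X x) - cov X x (Y x) = VectorField.mlieBracket I X Y x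
  metric (X Y : ∀ x : M, TangentSpace I x) (x : M) (u : TangentSpace I x)
    (hX : MDifferentiableAt I I.tangent (fun y ↦ (⟨y, X y⟩ : TangentBundle I M)) x)
    (hY : MDifferentiableAt I I.tangent (fun y ↦ (⟨y, Y y⟩ : TangentBundle I M)) x) :
    mvfderiv I (fun y ↦ g.inner y (X y) (Y y)) x u =
      g.inner x (cov X x u) (Y x) + g.inner x (X x) (cov Y x u)

section Submanifold

variable (J)

/-- `f : N → M` is the inclusion of an embedded submanifold on which `g` induces a
pseudo-Riemannian metric (for Riemannian `g` the nondegeneracy is automatic). -/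
structure IsNondegenerateEmbedding (g : PseudoRiemannianMetric I M)
    (f : N → M) : Prop where
  isSmoothEmbedding : Manifold.IsSmoothEmbedding J I ∞ f
  nondegenerate (p : N) (u : TangentSpace J p) (hu : ∀ v, g.pullback J f p u v = 0) : u = 0

/-- `B` is the second fundamental form of the submanifold `f : N → M` with respect to the
connection `cov` on `M`: `B p` takes values in the normal space at `f p`, and for every smooth
local extension `Z` of a vector field `Y` tangent to the submanifold, `B p u (Y p)` is the normal
component of `∇_{df u} Z`. -/
structure IsSecondFundamentalForm (g : PseudoRiemannianMetric I M)
    (cov : CovariantDerivative I E (fun x : M ↦ TangentSpace I x))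
    (f : N → M)
    (B : ∀ p : N, TangentSpace J p →ₗ[ℝ] TangentSpace J p →ₗ[ℝ] TangentSpace I (f p)) : Prop where
  normal (p : N) (u v w : TangentSpace J p) : g.inner (f p) (B p u v) (mfderiv J I f p w) = 0
  gauss (p : N) (u : TangentSpace J p)
    (Y : ∀ q : N, TangentSpace J q) (Z : ∀ x : M, TangentSpace I x)
    (hY : ContMDiffAt J J.tangent ∞ (fun q ↦ (⟨q, Y q⟩ : TangentBundle J N)) p)
    (hZ : ContMDiffAt I I.tangent ∞ (fun x ↦ (⟨x, Z x⟩ : TangentBundle I M)) (f p))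
    (hYZ : ∀ᶠ q in 𝓝 p, Z (f q) = mfderiv J I f q (Y q)) :
    ∃ t : TangentSpace J p,
      cov Z (f p) (mfderiv J I f p u) = mfderiv J I f p t + B p u (Y p)

/-- The submanifold `f : N → M` is totally geodesic: its second fundamental form with respect to
the Levi-Civita connection of `g` vanishes identically. -/
def IsTotallyGeodesic (g : PseudoRiemannianMetric I M)
    (f : N → M) : Prop :=
  ∀ cov, g.IsLeviCivita cov → g.IsSecondFundamentalForm J cov f (fun _ ↦ 0)

/-- The trace at `p`, with respect to the metric induced by `g`, of a bilinear map `b` on `T_p N`: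
`∑ᵢⱼ hⁱʲ b(eᵢ, eⱼ)`, where `(hⁱʲ)` is the inverse of the Gram matrix of a basis `(eᵢ)`. -/
noncomputable def metricTrace [FiniteDimensional ℝ E'] (g : PseudoRiemannianMetric I M)
    (f : N → M) (p : N)
    (b : TangentSpace J p →ₗ[ℝ] TangentSpace J p →ₗ[ℝ] TangentSpace I (f p)) :
    TangentSpace I (f p) :=
  let e : Fin (Module.finrank ℝ E') → TangentSpace J p := Module.finBasis ℝ E'
  ∑ i, ∑ j, (Matrix.of fun k l ↦ g.pullback J f p (e k) (e l))⁻¹ i j • b (e i) (e j)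

/-- The submanifold `f : N → M` is minimal: its mean curvature vector, the trace of the second
fundamental form, vanishes identically. -/
def IsMinimal [FiniteDimensional ℝ E'] (g : PseudoRiemannianMetric I M)
    (f : N → M) : Prop :=
  ∀ cov, g.IsLeviCivita cov → ∃ B, g.IsSecondFundamentalForm J cov f B ∧
    ∀ p : N, g.metricTrace J f p (B p) = 0

end Submanifold

/-- `g` is invariant under all left and all right translations. -/
def IsBiInvariant {G : Type*} [TopologicalSpace G] [ChartedSpace H G] [IsManifold I ∞ G] [Group G]
    (g : PseudoRiemannianMetric I G) : Prop :=
  (∀ a x : G, g.pullback I (fun y ↦ a * y) x = g.inner x) ∧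
    ∀ a x : G, g.pullback I (fun y ↦ y * a) x = g.inner x

end PseudoRiemannianMetric
end Metric

section VectorValued

variable {E : Type*} [NormedAddCommGroup E] [NormedSpace ℝ E]
  {H : Type*} [TopologicalSpace H] {I : ModelWithCorners ℝ E H}
  {M : Type*} [TopologicalSpace M] [ChartedSpace H M]

/-- The product rule for a continuous bilinear form. -/
theorem mvfderiv_bilin {F₁ F₂ : Type*} [NormedAddCommGroup F₁] [NormedSpace ℝ F₁]
    [NormedAddCommGroup F₂] [NormedSpace ℝ F₂] (b : F₁ →L[ℝ] F₂ →L[ℝ] ℝ) {f : M → F₁} {h : M → F₂}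
    {x : M} (hf : MDifferentiableAt I 𝓘(ℝ, F₁) f x) (hh : MDifferentiableAt I 𝓘(ℝ, F₂) h x)
    (u : TangentSpace I x) :
    mvfderiv I (fun y ↦ b (f y) (h y)) x u =
      b (mvfderiv I f x u) (h x) + b (f x) (mvfderiv I h x u) := by
  have hb := b.hasFDerivWithinAt_of_bilinear hf.hasMFDerivAt.2 hh.hasMFDerivAt.2
  have hc : ContinuousAt (fun y ↦ b (f y) (h y)) x :=
    b.isBoundedBilinearMap.continuous.continuousAt.comp
      (hf.continuousAt.prodMk hh.continuousAt)
  have key : HasMFDerivAt I 𝓘(ℝ, ℝ) (fun y ↦ b (f y) (h y)) x _ := ⟨hc, hb⟩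
  have e : mvfderiv I (fun y ↦ b (f y) (h y)) x u =
    mfderiv I 𝓘(ℝ, ℝ) (fun y ↦ b (f y) (h y)) x u := rfl
  rw [e, key.mfderiv]
  rw [add_comm]
  have hx : writtenInExtChartAt I 𝓘(ℝ, F₁) x f (extChartAt I x x) = f x :=
    congrArg f (extChartAt_to_inv x)
  have hx' : writtenInExtChartAt I 𝓘(ℝ, F₂) x h (extChartAt I x x) = h x :=
    congrArg h (extChartAt_to_inv x)
  rw [hx, hx']
  rfl

theorem mvfderiv_prodMk_neg {f h : M → E} {p : M} (hf : MDifferentiableAt I 𝓘(ℝ, E) f p)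
    (hh : MDifferentiableAt I 𝓘(ℝ, E) h p) (u : TangentSpace I p) :
    mvfderiv I (fun q ↦ (f q, -h q)) p u = (mvfderiv I f p u, -mvfderiv I h p u) := by
  have key : HasMFDerivAt I 𝓘(ℝ, E × E) (fun q ↦ (f q, -h q)) p _ :=
    ⟨hf.continuousAt.prodMk hh.continuousAt.neg, hf.hasMFDerivAt.2.prodMk hh.hasMFDerivAt.neg.2⟩
  exact congrArg (fun T : E →L[ℝ] E × E ↦ T u) key.mfderiv

end VectorValued

section Parallelization

variable {E : Type*} [NormedAddCommGroup E] [NormedSpace ℝ E]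
  {H : Type*} [TopologicalSpace H] {I : ModelWithCorners ℝ E H}
  {M : Type*} [TopologicalSpace M] [ChartedSpace H M] [IsManifold I ∞ M]

/-- A differentiable global trivialization of the tangent bundle. -/
structure IsParallelization (Θ : ∀ x : M, E ≃L[ℝ] TangentSpace I x) : Prop where
  mdifferentiableAt_section (v : E) (x : M) :
    MDifferentiableAt I I.tangent (fun y ↦ (⟨y, Θ y v⟩ : TangentBundle I M)) x
  mdifferentiableAt_coord {Y : ∀ x : M, TangentSpace I x} {x : M}
    (hY : MDifferentiableAt I I.tangent (fun y ↦ (⟨y, Y y⟩ : TangentBundle I M)) x) :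
    MDifferentiableAt I 𝓘(ℝ, E) (fun y ↦ (Θ y).symm (Y y)) x

namespace IsParallelization

variable {Θ Θ' : ∀ x : M, E ≃L[ℝ] TangentSpace I x}

/-- The flat connection for which the sections `y ↦ Θ y v` are parallel. -/
noncomputable def flatConnection (hΘ : IsParallelization Θ) :
    CovariantDerivative I E (fun x : M ↦ TangentSpace I x) where
  toFun Y x := (Θ x : E →L[ℝ] TangentSpace I x) ∘L mvfderiv I (fun y ↦ (Θ y).symm (Y y)) x
  isCovariantDerivativeOnUniv :=
    { add := by
        intro σ σ' x hσ hσ' _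
        have : (fun y ↦ (Θ y).symm ((σ + σ') y)) =
            (fun y ↦ (Θ y).symm (σ y)) + fun y ↦ (Θ y).symm (σ' y) := by
          ext y; simp
        rw [this, mvfderiv_add (hΘ.mdifferentiableAt_coord hσ) (hΘ.mdifferentiableAt_coord hσ')]
        ext u; simp
      leibniz := by
        intro σ f x hσ hf _
        have : (fun y ↦ (Θ y).symm ((f • σ) y)) = f • fun y ↦ (Θ y).symm (σ y) := by
          ext y; simp
        rw [this, mvfderiv_smul hf (hΘ.mdifferentiableAt_coord hσ)]
        ext u; simp }

theorem flatConnection_apply (hΘ : IsParallelization Θ) (Y : ∀ x : M, TangentSpace I x) (x : M)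
    (u : TangentSpace I x) :
    hΘ.flatConnection Y x u = Θ x (mvfderiv I (fun y ↦ (Θ y).symm (Y y)) x u) := rfl

theorem flatConnection_section (hΘ : IsParallelization Θ) (v : E) (x : M) :
    hΘ.flatConnection (fun y ↦ Θ y v) x = 0 := by
  ext u
  rw [flatConnection_apply]
  simp [mvfderiv_const]

/-- The mean of the flat connections of two parallelizations. -/
noncomputable def meanConnection (hΘ : IsParallelization Θ) (hΘ' : IsParallelization Θ') :
    CovariantDerivative I E (fun x : M ↦ TangentSpace I x) where
  toFun := fun σ ↦ ((fun _ ↦ (1 / 2 : ℝ)) : M → ℝ) • hΘ.flatConnection σ +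
      (1 - ((fun _ ↦ (1 / 2 : ℝ)) : M → ℝ)) • hΘ'.flatConnection σ
  isCovariantDerivativeOnUniv := hΘ.flatConnection.isCovariantDerivativeOnUniv.affine_combination
    hΘ'.flatConnection.isCovariantDerivativeOnUniv _

theorem meanConnection_apply (hΘ : IsParallelization Θ) (hΘ' : IsParallelization Θ')
    (Y : ∀ x : M, TangentSpace I x) (x : M) (u : TangentSpace I x) :
    meanConnection hΘ hΘ' Y x u =
      (1 / 2 : ℝ) • (hΘ.flatConnection Y x u + hΘ'.flatConnection Y x u) := by
  have : meanConnection hΘ hΘ' Y x u = (1 / 2 : ℝ) • hΘ.flatConnection Y x u +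
    (1 - 1 / 2 : ℝ) • hΘ'.flatConnection Y x u := rfl
  rw [this, smul_add]
  norm_num

theorem flatConnection_metric (hΘ : IsParallelization Θ) (g : PseudoRiemannianMetric I M)
    (b : E →L[ℝ] E →L[ℝ] ℝ) (hb : ∀ x v w, g.inner x (Θ x v) (Θ x w) = b v w)
    (X Y : ∀ x : M, TangentSpace I x) (x : M) (u : TangentSpace I x)
    (hX : MDifferentiableAt I I.tangent (fun y ↦ (⟨y, X y⟩ : TangentBundle I M)) x)
    (hY : MDifferentiableAt I I.tangent (fun y ↦ (⟨y, Y y⟩ : TangentBundle I M)) x) :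
    mvfderiv I (fun y ↦ g.inner y (X y) (Y y)) x u =
      g.inner x (hΘ.flatConnection X x u) (Y x) + g.inner x (X x) (hΘ.flatConnection Y x u) := by
  have h1 : (fun y ↦ g.inner y (X y) (Y y)) =
      fun y ↦ b ((Θ y).symm (X y)) ((Θ y).symm (Y y)) := by
    ext y; rw [← hb y]; simp
  rw [h1, mvfderiv_bilin b (hΘ.mdifferentiableAt_coord hX) (hΘ.mdifferentiableAt_coord hY),
    flatConnection_apply, flatConnection_apply, ← hb x, ← hb x]
  simp

/-- If the sections of two parallelizations commute, the flat connections are related by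
`∇_X Y - ∇'_Y X = [X, Y]`. -/
theorem flatConnection_sub_flatConnection [FiniteDimensional ℝ E]
    (hΘ : IsParallelization Θ) (hΘ' : IsParallelization Θ')
    (hcomm : ∀ v w x, VectorField.mlieBracket I (fun y ↦ Θ' y v) (fun y ↦ Θ y w) x = 0)
    (X Y : ∀ x : M, TangentSpace I x) (x : M)
    (hX : MDifferentiableAt I I.tangent (fun y ↦ (⟨y, X y⟩ : TangentBundle I M)) x)
    (hY : MDifferentiableAt I I.tangent (fun y ↦ (⟨y, Y y⟩ : TangentBundle I M)) x) :
    hΘ.flatConnection Y x (X x) - hΘ'.flatConnection X x (Y x) =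
      VectorField.mlieBracket I X Y x := by
  have : IsManifold I 1 M := .of_le (n := ∞) (by norm_cast)
  have : IsManifold I 2 M := .of_le (n := ∞) (by norm_cast)
  have : CompleteSpace E := FiniteDimensional.complete ℝ E
  let Φ : (∀ x : M, TangentSpace I x) → (∀ x : M, TangentSpace I x) → TangentSpace I x :=
    fun X Y ↦ hΘ.flatConnection Y x (X x) - hΘ'.flatConnection X x (Y x) -
      VectorField.mlieBracket I X Y x
  have h1 (Y) (_ : MDifferentiableAt I I.tangent (fun y ↦ (⟨y, Y y⟩ : TangentBundle I M)) x) :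
      TensorialAt I E (Φ · Y) x :=
    { smul := by
        intro f σ hf hσ
        simp [Φ, hΘ'.flatConnection.isCovariantDerivativeOnUniv.leibniz hσ hf,
          VectorField.mlieBracket_smul_left hf hσ]
        module
      add := by
        intro σ σ' hσ hσ'
        simp [Φ, hΘ'.flatConnection.isCovariantDerivativeOnUniv.add hσ hσ',
          VectorField.mlieBracket_add_left hσ hσ']
        module }
  have h2 (X) (_ : MDifferentiableAt I I.tangent (fun y ↦ (⟨y, X y⟩ : TangentBundle I M)) x) :
      TensorialAt I E (Φ X ·) x :=
    { smul := by
        intro f σ hf hσ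
        simp [Φ, hΘ.flatConnection.isCovariantDerivativeOnUniv.leibniz hσ hf,
          VectorField.mlieBracket_smul_right hf hσ]
        module
      add := by
        intro σ σ' hσ hσ'
        simp [Φ, hΘ.flatConnection.isCovariantDerivativeOnUniv.add hσ hσ',
          VectorField.mlieBracket_add_right hσ hσ']
        module }
  have key := TensorialAt.pointwise₂ h1 h2 hX
    (hΘ'.mdifferentiableAt_section ((Θ' x).symm (X x)) x) hY
    (hΘ.mdifferentiableAt_section ((Θ x).symm (Y x)) x) (by simp) (by simp)
  simp only [Φ, flatConnection_section, hcomm] at key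
  rw [← sub_eq_zero, key]
  simp

theorem meanConnection_isLeviCivita [FiniteDimensional ℝ E]
    (hΘ : IsParallelization Θ) (hΘ' : IsParallelization Θ') (g : PseudoRiemannianMetric I M)
    (b b' : E →L[ℝ] E →L[ℝ] ℝ) (hb : ∀ x v w, g.inner x (Θ x v) (Θ x w) = b v w)
    (hb' : ∀ x v w, g.inner x (Θ' x v) (Θ' x w) = b' v w)
    (hcomm : ∀ v w x, VectorField.mlieBracket I (fun y ↦ Θ' y v) (fun y ↦ Θ y w) x = 0) :
    g.IsLeviCivita (meanConnection hΘ hΘ') where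
  torsion_free X Y x hX hY := by
    have h1 := flatConnection_sub_flatConnection hΘ hΘ' hcomm X Y x hX hY
    have h2 := flatConnection_sub_flatConnection hΘ hΘ' hcomm Y X x hY hX
    rw [VectorField.mlieBracket_swap_apply] at h2
    have h3 := sub_eq_iff_eq_add.1 h1
    have h4 := sub_eq_iff_eq_add.1 h2
    rw [meanConnection_apply, meanConnection_apply, h3, h4]
    module
  metric X Y x u hX hY := by
    have h1 := flatConnection_metric hΘ g b hb X Y x u hX hY
    have h2 := flatConnection_metric hΘ' g b' hb' X Y x u hX hY
    rw [meanConnection_apply, meanConnection_apply]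
    simp only [map_smul, map_add, smul_apply, add_apply, smul_eq_mul]
    linarith

end IsParallelization

namespace PseudoRiemannianMetric

/-- The Levi-Civita connection is determined by the metric on differentiable fields. -/
theorem IsLeviCivita.unique [FiniteDimensional ℝ E] {g : PseudoRiemannianMetric I M}
    {cov cov' : CovariantDerivative I E (fun x : M ↦ TangentSpace I x)}
    (h : g.IsLeviCivita cov) (h' : g.IsLeviCivita cov') {Y : ∀ x : M, TangentSpace I x} {x : M}
    (hY : MDifferentiableAt I I.tangent (fun y ↦ (⟨y, Y y⟩ : TangentBundle I M)) x) :
    cov Y x = cov' Y x := by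
  have : IsManifold I 1 M := .of_le (n := ∞) (by norm_cast)
  let A (v u : TangentSpace I x) : TangentSpace I x :=
    cov (FiberBundle.extend E v) x u - cov' (FiberBundle.extend E v) x u
  have hd (v : TangentSpace I x) : MDifferentiableAt I I.tangent
      (fun y ↦ (⟨y, FiberBundle.extend E v y⟩ : TangentBundle I M)) x :=
    FiberBundle.mdifferentiableAt_extend ..
  have hA {Z : ∀ x : M, TangentSpace I x}
      (hZ : MDifferentiableAt I I.tangent (fun y ↦ (⟨y, Z y⟩ : TangentBundle I M)) x)
      (u : TangentSpace I x) : cov Z x u - cov' Z x u = A (Z x) u := by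
    have e1 := cov.isCovariantDerivativeOnUniv.difference_apply
      cov'.isCovariantDerivativeOnUniv (x := x) trivial hZ
    have e2 := cov.isCovariantDerivativeOnUniv.difference_apply
      cov'.isCovariantDerivativeOnUniv (x := x) trivial (hd (Z x))
    rw [FiberBundle.extend_apply_self] at e2
    have e3 := e1.symm.trans e2
    exact congrArg (fun T : TangentSpace I x →L[ℝ] TangentSpace I x ↦ T u) e3
  have symm (v u : TangentSpace I x) : A v u = A u v := by
    have h1 := h.torsion_free _ _ x (hd u) (hd v)
    have h2 := h'.torsion_free _ _ x (hd u) (hd v)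
    simp only [FiberBundle.extend_apply_self] at h1 h2
    have h3 := h1.trans h2.symm
    have : A v u - A u v = 0 := by
      simp only [A]
      rw [← sub_eq_zero] at h3
      rw [← h3]; abel
    exact sub_eq_zero.1 this
  have skew (v w u : TangentSpace I x) : g.inner x (A v u) w + g.inner x v (A w u) = 0 := by
    have h1 := h.metric _ _ x u (hd v) (hd w)
    have h2 := h'.metric _ _ x u (hd v) (hd w)
    simp only [FiberBundle.extend_apply_self] at h1 h2
    simp only [A, map_sub, sub_apply]
    linarith
  have zero (v u : TangentSpace I x) : A v u = 0 := by
    refine g.nondegenerate x _ fun w ↦ ?_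
    have e1 := skew v w u
    have e2 := skew w u v
    have e3 := skew u v w
    rw [symm v u, g.symm x v] at e1
    rw [symm w v, g.symm x w] at e2
    rw [symm u w, g.symm x u, symm v w] at e3
    rw [symm w u] at e1 e3
    rw [symm v u]
    rw [symm v w] at e2
    linarith
  ext u
  exact sub_eq_zero.1 ((hA hY u).trans (zero _ _))

end PseudoRiemannianMetric

end Parallelization

section LieBracket

variable {E₁ E₂ E : Type*} [NormedAddCommGroup E₁] [NormedSpace ℝ E₁]
  [NormedAddCommGroup E₂] [NormedSpace ℝ E₂] [NormedAddCommGroup E] [NormedSpace ℝ E]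

/-- Two vector fields which are the coordinate derivatives of a map of two variables commute. -/
theorem lieBracket_eq_zero_of_partial {F : E₁ × E₂ → E} {s₀ : E₁} {t₀ : E₂}
    (hF : ContDiffAt ℝ 2 F (s₀, t₀)) {V W : E → E} (a : E₁) (b : E₂)
    (hV : DifferentiableAt ℝ V (F (s₀, t₀))) (hW : DifferentiableAt ℝ W (F (s₀, t₀)))
    (hVF : ∀ᶠ t in 𝓝 t₀, V (F (s₀, t)) = fderiv ℝ (fun s ↦ F (s, t)) s₀ a)
    (hWF : ∀ᶠ s in 𝓝 s₀, W (F (s, t₀)) = fderiv ℝ (fun t ↦ F (s, t)) t₀ b) :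
    VectorField.lieBracket ℝ V W (F (s₀, t₀)) = 0 := by
  have hd : ∀ᶠ p in 𝓝 (s₀, t₀), DifferentiableAt ℝ F p := by
    filter_upwards [hF.eventually (by simp)] with p hp using hp.differentiableAt (by simp)
  have hd2 : DifferentiableAt ℝ (fderiv ℝ F) (s₀, t₀) :=
    (hF.fderiv_right (m := 1) (by norm_num)).differentiableAt (by simp)
  have h1 (s : E₁) (t : E₂) : HasFDerivAt (fun s : E₁ ↦ (s, t)) (.inl ℝ E₁ E₂) s :=
    hasFDerivAt_prodMk_left s t
  have h2 (s : E₁) (t : E₂) : HasFDerivAt (fun t : E₂ ↦ (s, t)) (.inr ℝ E₁ E₂) t :=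
    hasFDerivAt_prodMk_right s t
  have hV' : (fun t ↦ V (F (s₀, t))) =ᶠ[𝓝 t₀] fun t ↦ fderiv ℝ F (s₀, t) (a, 0) := by
    filter_upwards [hVF, (h2 s₀ t₀).continuousAt.eventually hd] with t ht ht'
    have e : HasFDerivAt (fun s ↦ F (s, t)) _ s₀ := ht'.hasFDerivAt.comp s₀ (h1 s₀ t)
    rw [ht, e.fderiv]
    simp
  have hW' : (fun s ↦ W (F (s, t₀))) =ᶠ[𝓝 s₀] fun s ↦ fderiv ℝ F (s, t₀) (0, b) := by
    filter_upwards [hWF, (h1 s₀ t₀).continuousAt.eventually hd] with s hs hs'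
    have e : HasFDerivAt (fun t ↦ F (s, t)) _ t₀ := hs'.hasFDerivAt.comp t₀ (h2 s t₀)
    rw [hs, e.fderiv]
    simp
  have hF0 := hd.self_of_nhds.hasFDerivAt
  have dV : fderiv ℝ V (F (s₀, t₀)) (fderiv ℝ F (s₀, t₀) (0, b)) =
      fderiv ℝ (fderiv ℝ F) (s₀, t₀) (0, b) (a, 0) := by
    have e1 : HasFDerivAt (fun t ↦ V (F (s₀, t))) _ t₀ :=
      hV.hasFDerivAt.comp t₀ (hF0.comp t₀ (h2 s₀ t₀))
    have e2 : HasFDerivAt (fun t ↦ fderiv ℝ F (s₀, t) (a, 0)) _ t₀ :=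
      (hd2.hasFDerivAt.comp t₀ (h2 s₀ t₀)).clm_apply (hasFDerivAt_const (a, (0 : E₂)) t₀)
    have e3 := congrArg (fun T : E₂ →L[ℝ] E ↦ T b) (e1.unique (e2.congr_of_eventuallyEq hV'))
    simpa using e3
  have dW : fderiv ℝ W (F (s₀, t₀)) (fderiv ℝ F (s₀, t₀) (a, 0)) =
      fderiv ℝ (fderiv ℝ F) (s₀, t₀) (a, 0) (0, b) := by
    have e1 : HasFDerivAt (fun s ↦ W (F (s, t₀))) _ s₀ :=
      hW.hasFDerivAt.comp s₀ (hF0.comp s₀ (h1 s₀ t₀))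
    have e2 : HasFDerivAt (fun s ↦ fderiv ℝ F (s, t₀) (0, b)) _ s₀ :=
      (hd2.hasFDerivAt.comp s₀ (h1 s₀ t₀)).clm_apply (hasFDerivAt_const ((0 : E₁), b) s₀)
    have e3 := congrArg (fun T : E₁ →L[ℝ] E ↦ T a) (e1.unique (e2.congr_of_eventuallyEq hW'))
    simpa using e3
  have hs : IsSymmSndFDerivAt ℝ F (s₀, t₀) := hF.isSymmSndFDerivAt (by simp)
  rw [VectorField.lieBracket_eq]
  dsimp only
  have hV0 := hV'.self_of_nhds
  have hW0 := hW'.self_of_nhds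
  dsimp only at hV0 hW0
  rw [hV0, hW0, dV, dW, hs.eq, sub_self]

end LieBracket

section LieGroup

variable {E : Type*} [NormedAddCommGroup E] [NormedSpace ℝ E]
  {H : Type*} [TopologicalSpace H] {I : ModelWithCorners ℝ E H}

theorem TangentBundle.mk_congr {M : Type*} [TopologicalSpace M] [ChartedSpace H M]
    {p q : M} (h : p = q) (w : E) : (⟨p, w⟩ : TangentBundle I M) = ⟨q, w⟩ := by
  subst h; rfl

/-- The partial derivative of a map of two variables along a field is differentiable. -/
theorem mdifferentiableAt_mfderiv_partial {M : Type*} [TopologicalSpace M] [ChartedSpace H M]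
    [IsManifold I ∞ M] {μ : M × M → M} (hμ : ContMDiff (I.prod I) I ∞ μ) {a b : M → M} {x : M}
    (ha : MDifferentiableAt I I a x) {Y : ∀ y, TangentSpace I (b y)}
    (hY : MDifferentiableAt I I.tangent (fun y ↦ (⟨b y, Y y⟩ : TangentBundle I M)) x) :
    MDifferentiableAt I I.tangent (fun y ↦ (⟨μ (a y, b y),
      mfderiv I I (fun z ↦ μ (a y, z)) (b y) (Y y)⟩ : TangentBundle I M)) x := by
  have : IsManifold I 1 M := .of_le (n := ∞) (by norm_cast)
  have h0 : MDifferentiableAt I I.tangent (fun y ↦ (⟨a y, 0⟩ : TangentBundle I M)) x :=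
    ((contMDiff_zeroSection ℝ (n := 1) (TangentSpace I : M → Type _)).mdifferentiable
      one_ne_zero _).comp x ha
  have h1 := h0.prodMk hY
  have h2 : MDifferentiable (I.tangent.prod I.tangent) (I.prod I).tangent
      (equivTangentBundleProd I M I M).symm :=
    (contMDiff_equivTangentBundleProd_symm (n := 1)).mdifferentiable one_ne_zero
  have h3 : MDifferentiable (I.prod I).tangent I.tangent (tangentMap (I.prod I) I μ) :=
    (hμ.contMDiff_tangentMap (m := 1) (by norm_cast)).mdifferentiable one_ne_zero
  have h4 := (h3 _).comp x ((h2 _).comp x h1)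
  refine h4.congr_of_eventuallyEq (Eventually.of_forall fun y ↦ ?_)
  refine Bundle.TotalSpace.ext rfl (heq_of_eq ?_)
  simp only [Function.comp_apply, tangentMap, equivTangentBundleProd]
  have := mfderiv_prod_eq_add_apply (p := (a y, b y)) (v := (((0 : E), (Y y : E)) : E × E))
    ((hμ.mdifferentiable (by simp)) (a y, b y))
  refine Eq.trans ?_ this.symm
  have h0 : mfderiv I I (fun z ↦ μ (z, b y)) (a y) (0 : E) = 0 := map_zero _
  change _ = mfderiv I I (fun z ↦ μ (z, b y)) (a y) (0 : E) + _
  rw [h0, zero_add]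

variable {G : Type*} [Group G] [TopologicalSpace G] [ChartedSpace H G] [LieGroup I ∞ G]

theorem mdifferentiableAt_of_mk_one {σ : G → E} {x : G}
    (h : MDifferentiableAt I I.tangent (fun y ↦ (⟨(1 : G), σ y⟩ : TangentBundle I G)) x) :
    MDifferentiableAt I 𝓘(ℝ, E) σ x := by
  have : IsManifold I 1 G := .of_le (n := ∞) (by norm_cast)
  have h1 := ((mdifferentiableAt_totalSpace _ _).1 h).2
  refine h1.congr_of_eventuallyEq (Eventually.of_forall fun y ↦ ?_)
  exact ((tangentBundleCore I G).coordChange_self (achart H 1) 1 (mem_achart_source H 1) _).symm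

variable (I) in
theorem mdifferentiable_mul_left' (a : G) : MDifferentiable I I (a * ·) :=
  (contMDiff_mul_left (n := ∞)).mdifferentiable (by simp)

variable (I) in
theorem mdifferentiable_mul_right' (a : G) : MDifferentiable I I (· * a) :=
  (contMDiff_mul_right (n := ∞)).mdifferentiable (by simp)

theorem mfderiv_mul_left_inv_apply (a x : G) (v : TangentSpace I x) :
    (mfderiv I I (a⁻¹ * ·) (a * x) (mfderiv I I (a * ·) x v) : E) = v := by
  have h := mfderiv_comp_apply x (mdifferentiable_mul_left' I a⁻¹ (a * x))
    (mdifferentiable_mul_left' I a x) v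
  have e : (a⁻¹ * ·) ∘ (a * ·) = (id : G → G) := by ext; simp
  rw [← h, e, mfderiv_id]
  rfl

theorem mfderiv_mul_right_inv_apply (a x : G) (v : TangentSpace I x) :
    (mfderiv I I (· * a⁻¹) (x * a) (mfderiv I I (· * a) x v) : E) = v := by
  have h := mfderiv_comp_apply x (mdifferentiable_mul_right' I a⁻¹ (x * a))
    (mdifferentiable_mul_right' I a x) v
  have e : (· * a⁻¹) ∘ (· * a) = (id : G → G) := by ext; simp
  rw [← h, e, mfderiv_id]
  rfl

variable (I) in
/-- The trivialization of the tangent bundle by left translations. -/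
noncomputable def leftTrivialization (x : G) : E ≃L[ℝ] TangentSpace I x :=
  ContinuousLinearEquiv.equivOfInverse (M₁ := E) (M₂ := TangentSpace I x)
    (mfderiv I I (x * ·) (1 : G) : E →L[ℝ] E) (mfderiv I I (x⁻¹ * ·) x : E →L[ℝ] E)
    (fun v ↦ by
      have := mfderiv_mul_left_inv_apply (I := I) x 1 v
      rwa [mul_one] at this)
    (fun v ↦ by
      have := mfderiv_mul_left_inv_apply (I := I) x⁻¹ x v
      rwa [inv_inv, inv_mul_cancel] at this)

variable (I) in
/-- The trivialization of the tangent bundle by right translations. -/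
noncomputable def rightTrivialization (x : G) : E ≃L[ℝ] TangentSpace I x :=
  ContinuousLinearEquiv.equivOfInverse (M₁ := E) (M₂ := TangentSpace I x)
    (mfderiv I I (· * x) (1 : G) : E →L[ℝ] E) (mfderiv I I (· * x⁻¹) x : E →L[ℝ] E)
    (fun v ↦ by
      have := mfderiv_mul_right_inv_apply (I := I) x 1 v
      rwa [one_mul] at this)
    (fun v ↦ by
      have := mfderiv_mul_right_inv_apply (I := I) x⁻¹ x v
      rwa [inv_inv, mul_inv_cancel] at this)

theorem leftTrivialization_symm_apply (x : G) (v : TangentSpace I x) :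
    (leftTrivialization I x).symm v = mfderiv I I (x⁻¹ * ·) x v := rfl

theorem rightTrivialization_symm_apply (x : G) (v : TangentSpace I x) :
    (rightTrivialization I x).symm v = mfderiv I I (· * x⁻¹) x v := rfl

theorem isParallelization_leftTrivialization :
    IsParallelization (fun x : G ↦ leftTrivialization I x) where
  mdifferentiableAt_section v x := by
    have := mdifferentiableAt_mfderiv_partial (I := I) (μ := fun p : G × G ↦ p.1 * p.2)
      (contMDiff_mul I ∞) (a := id) (b := fun _ ↦ 1) (x := x) mdifferentiableAt_id
      (Y := fun _ ↦ v) mdifferentiableAt_const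
    refine this.congr_of_eventuallyEq (Eventually.of_forall fun y ↦ ?_)
    exact TangentBundle.mk_congr (mul_one y).symm _
  mdifferentiableAt_coord {Y x} hY := by
    have := mdifferentiableAt_mfderiv_partial (I := I) (μ := fun p : G × G ↦ p.1⁻¹ * p.2)
      (contMDiff_fst.inv.mul contMDiff_snd) (a := id) (b := id) (x := x)
      mdifferentiableAt_id (Y := Y) hY
    refine mdifferentiableAt_of_mk_one
      (this.congr_of_eventuallyEq (Eventually.of_forall fun y ↦ ?_))
    exact TangentBundle.mk_congr (inv_mul_cancel y).symm _

theorem isParallelization_rightTrivialization :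
    IsParallelization (fun x : G ↦ rightTrivialization I x) where
  mdifferentiableAt_section v x := by
    have := mdifferentiableAt_mfderiv_partial (I := I) (μ := fun p : G × G ↦ p.2 * p.1)
      (contMDiff_snd.mul contMDiff_fst) (a := id) (b := fun _ ↦ 1) (x := x) mdifferentiableAt_id
      (Y := fun _ ↦ v) mdifferentiableAt_const
    refine this.congr_of_eventuallyEq (Eventually.of_forall fun y ↦ ?_)
    exact TangentBundle.mk_congr (one_mul y).symm _
  mdifferentiableAt_coord {Y x} hY := by
    have := mdifferentiableAt_mfderiv_partial (I := I) (μ := fun p : G × G ↦ p.2 * p.1⁻¹)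
      (contMDiff_snd.mul contMDiff_fst.inv) (a := id) (b := id) (x := x)
      mdifferentiableAt_id (Y := Y) hY
    refine mdifferentiableAt_of_mk_one
      (this.congr_of_eventuallyEq (Eventually.of_forall fun y ↦ ?_))
    exact TangentBundle.mk_congr (mul_inv_cancel y).symm _

end LieGroup

section BiInvariant

variable {E : Type*} [NormedAddCommGroup E] [NormedSpace ℝ E]
  {H : Type*} [TopologicalSpace H] {I : ModelWithCorners ℝ E H}

theorem mpullbackWithin_extChartAt_symm {M : Type*} [TopologicalSpace M] [ChartedSpace H M]
    [IsManifold I 1 M] (X : ∀ y : M, TangentSpace I y) (x : M) {z : E}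
    (hz : z ∈ (extChartAt I x).target) :
    VectorField.mpullbackWithin 𝓘(ℝ, E) I (extChartAt I x).symm X (Set.range I) z =
      mfderiv I 𝓘(ℝ, E) (extChartAt I x) ((extChartAt I x).symm z)
        (X ((extChartAt I x).symm z)) := by
  rw [VectorField.mpullbackWithin_apply, ContinuousLinearMap.inverse_eq
    (mfderivWithin_extChartAt_symm_comp_mfderiv_extChartAt hz)
    (mfderiv_extChartAt_comp_mfderivWithin_extChartAt_symm hz)]
  rfl

theorem fderiv_extChartAt_comp_extChartAt_symm {M : Type*} [TopologicalSpace M]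
    [ChartedSpace H M] [IsManifold I 1 M] [I.Boundaryless] {f : M → M} {x p q : M}
    (hf : MDifferentiableAt I I f p) (hq : f p = q) (hx : q ∈ (extChartAt I x).source) (v : E) :
    fderiv ℝ (fun s ↦ extChartAt I x (f ((extChartAt I p).symm s))) (extChartAt I p p) v =
      mfderiv I 𝓘(ℝ, E) (extChartAt I x) q (mfderiv I I f p v) := by
  subst hq
  have hφ : MDifferentiableAt I 𝓘(ℝ, E) (extChartAt I x) (f p) :=
    mdifferentiableAt_extChartAt (by simpa using hx)
  have h1 := mfderiv_comp_apply p hφ hf v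
  have h2 := (hφ.comp p hf).mfderiv
  rw [I.range_eq_univ, fderivWithin_univ] at h2
  rw [← h1, h2]
  rfl

variable {G : Type*} [Group G] [TopologicalSpace G] [ChartedSpace H G] [LieGroup I ∞ G]

/-- Right-invariant fields commute with left-invariant fields. -/
theorem mlieBracket_rightTrivialization_leftTrivialization [CompleteSpace E] [I.Boundaryless]
    (v w : E) (x : G) :
    VectorField.mlieBracket I (fun y : G ↦ rightTrivialization I y v)
      (fun y : G ↦ leftTrivialization I y w) x = 0 := by
  have : IsManifold I 1 G := .of_le (n := ∞) (by norm_cast)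
  have : IsManifold I 2 G := .of_le (n := ∞) (by norm_cast)
  obtain ⟨V, hV⟩ : ∃ V : E → E, V = VectorField.mpullbackWithin 𝓘(ℝ, E) I
    (extChartAt I x).symm (fun y : G ↦ rightTrivialization I y v) (Set.range I) := ⟨_, rfl⟩
  have hVd : DifferentiableAt ℝ V (extChartAt I x x) := by
    have := MDifferentiableWithinAt.differentiableWithinAt_mpullbackWithin_vectorField
      ((isParallelization_rightTrivialization (I := I) (G := G)).mdifferentiableAt_section v
        x).mdifferentiableWithinAt (s := Set.univ)
    rw [hV]
    exact this.differentiableAt (by simp [I.range_eq_univ])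
  obtain ⟨W, hW⟩ : ∃ W : E → E, W = VectorField.mpullbackWithin 𝓘(ℝ, E) I
    (extChartAt I x).symm (fun y : G ↦ leftTrivialization I y w) (Set.range I) := ⟨_, rfl⟩
  have hWd : DifferentiableAt ℝ W (extChartAt I x x) := by
    have := MDifferentiableWithinAt.differentiableWithinAt_mpullbackWithin_vectorField
      ((isParallelization_leftTrivialization (I := I) (G := G)).mdifferentiableAt_section w
        x).mdifferentiableWithinAt (s := Set.univ)
    rw [hW]
    exact this.differentiableAt (by simp [I.range_eq_univ])
  set φ := extChartAt I x with hφ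
  set ψ := extChartAt I (1 : G) with hψ
  let F : E × E → E := fun p ↦ φ (ψ.symm p.1 * x * ψ.symm p.2)
  have hψ1 : ψ.symm (ψ 1) = 1 := extChartAt_to_inv 1
  have hF0 : F (ψ 1, ψ 1) = φ x := by simp [F, hψ1]
  have hψs : ContMDiffAt 𝓘(ℝ, E) I ∞ ψ.symm (ψ 1) := by
    have := contMDiffWithinAt_extChartAt_symm_range_self (I := I) (n := ∞) (1 : G)
    rwa [I.range_eq_univ, contMDiffWithinAt_univ] at this
  have hP : ContMDiffAt 𝓘(ℝ, E × E) I ∞ (fun p : E × E ↦ ψ.symm p.1 * x * ψ.symm p.2)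
      (ψ 1, ψ 1) := by
    have h1 : ContMDiffAt 𝓘(ℝ, E × E) I ∞ (fun p : E × E ↦ ψ.symm p.1) (ψ 1, ψ 1) :=
      hψs.comp (ψ 1, ψ 1) contDiff_fst.contMDiff.contMDiffAt
    have h2 : ContMDiffAt 𝓘(ℝ, E × E) I ∞ (fun p : E × E ↦ ψ.symm p.2) (ψ 1, ψ 1) :=
      hψs.comp (ψ 1, ψ 1) contDiff_snd.contMDiff.contMDiffAt
    exact (h1.mul contMDiffAt_const).mul h2
  have hF : ContDiffAt ℝ 2 F (ψ 1, ψ 1) := by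
    have h1 : ContMDiffAt I 𝓘(ℝ, E) ∞ φ (ψ.symm (ψ 1) * x * ψ.symm (ψ 1)) := by
      rw [hψ1, one_mul, mul_one]
      exact contMDiffAt_extChartAt
    have h2 : ContMDiffAt 𝓘(ℝ, E × E) 𝓘(ℝ, E) ∞ F (ψ 1, ψ 1) := h1.comp (ψ 1, ψ 1) hP
    exact h2.contDiffAt.of_le (by norm_cast)
  have hsrc : ∀ᶠ p in 𝓝 (ψ 1, ψ 1), ψ.symm p.1 * x * ψ.symm p.2 ∈ φ.source := by
    refine hP.continuousAt.eventually_mem ?_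
    simp only [hψ1, one_mul, mul_one]
    exact extChartAt_source_mem_nhds x
  have key := lieBracket_eq_zero_of_partial hF (V := V) (W := W) v w
    (by rwa [hF0]) (by rwa [hF0]) ?_ ?_
  · have e : VectorField.lieBracketWithin ℝ V W (φ.symm ⁻¹' Set.univ ∩ Set.range I) (φ x) = 0 := by
      rw [Set.preimage_univ, Set.univ_inter, I.range_eq_univ, VectorField.lieBracketWithin_univ,
        ← hF0, key]
    rw [hV, hW] at e
    rw [← VectorField.mlieBracketWithin_univ, VectorField.mlieBracketWithin_apply]
    exact (congrArg _ e).trans (map_zero _)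
  · have hc : ContinuousAt (fun t : E ↦ (ψ 1, t)) (ψ 1) := by fun_prop
    filter_upwards [hc.eventually hsrc] with t ht'
    have ht : ψ.symm (ψ 1) * x * ψ.symm t ∈ φ.source := ht'
    refine (congrFun hV _).trans ((mpullbackWithin_extChartAt_symm _ x
      (φ.map_source ht)).trans ?_)
    rw [← hφ, φ.left_inv ht]
    have h := fderiv_extChartAt_comp_extChartAt_symm (I := I) (x := x) (p := 1)
      (mdifferentiable_mul_right' I (ψ.symm (ψ 1) * x * ψ.symm t) 1) (one_mul _) ht v
    refine Eq.trans h.symm ?_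
    rw [← hφ, ← hψ]
    simp only [F, hψ1, one_mul, mul_assoc]
    rfl
  · have hc : ContinuousAt (fun s : E ↦ (s, ψ 1)) (ψ 1) := by fun_prop
    filter_upwards [hc.eventually hsrc] with s hs'
    have hs : ψ.symm s * x * ψ.symm (ψ 1) ∈ φ.source := hs'
    refine (congrFun hW _).trans ((mpullbackWithin_extChartAt_symm _ x
      (φ.map_source hs)).trans ?_)
    rw [← hφ, φ.left_inv hs]
    have h := fderiv_extChartAt_comp_extChartAt_symm (I := I) (x := x) (p := 1)
      (mdifferentiable_mul_left' I (ψ.symm s * x * ψ.symm (ψ 1)) 1) (mul_one _) hs w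
    refine Eq.trans h.symm ?_
    rw [← hφ, ← hψ]
    simp only [F, hψ1, mul_one]
    rfl

namespace PseudoRiemannianMetric

variable (g : PseudoRiemannianMetric I G)

theorem inner_congr {p q : G} (h : p = q) (v w : E) : g.inner p v w = g.inner q v w := by
  subst h; rfl

variable {g}

theorem IsBiInvariant.inner_mfderiv_mul_left (hg : g.IsBiInvariant) (a x : G)
    (v w : TangentSpace I x) :
    g.inner (a * x) (mfderiv I I (a * ·) x v) (mfderiv I I (a * ·) x w) = g.inner x v w := by
  rw [← hg.1 a x]; rfl

theorem IsBiInvariant.inner_mfderiv_mul_right (hg : g.IsBiInvariant) (a x : G)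
    (v w : TangentSpace I x) :
    g.inner (x * a) (mfderiv I I (· * a) x v) (mfderiv I I (· * a) x w) = g.inner x v w := by
  rw [← hg.2 a x]; rfl

theorem IsBiInvariant.inner_leftTrivialization (hg : g.IsBiInvariant) (x : G) (v w : E) :
    g.inner x (leftTrivialization I x v) (leftTrivialization I x w) = g.inner 1 v w :=
  (g.inner_congr (mul_one x).symm _ _).trans (hg.inner_mfderiv_mul_left x 1 v w)

theorem IsBiInvariant.inner_rightTrivialization (hg : g.IsBiInvariant) (x : G) (v w : E) :
    g.inner x (rightTrivialization I x v) (rightTrivialization I x w) = g.inner 1 v w :=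
  (g.inner_congr (one_mul x).symm _ _).trans (hg.inner_mfderiv_mul_right x 1 v w)

/-- The Levi-Civita connection of a bi-invariant metric is the mean of the flat connections given
by left and right translations. -/
theorem IsBiInvariant.isLeviCivita_meanConnection [FiniteDimensional ℝ E] [I.Boundaryless]
    (hg : g.IsBiInvariant) :
    g.IsLeviCivita (IsParallelization.meanConnection
      (isParallelization_leftTrivialization (I := I) (G := G))
      isParallelization_rightTrivialization) :=
  have : CompleteSpace E := FiniteDimensional.complete ℝ E
  IsParallelization.meanConnection_isLeviCivita _ _ g (g.inner 1) (g.inner 1)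
    hg.inner_leftTrivialization hg.inner_rightTrivialization
    mlieBracket_rightTrivialization_leftTrivialization

end PseudoRiemannianMetric

end BiInvariant

section AntiDiagonal

theorem twistedConjClass_one (G : Type*) [Group G] :
    twistedConjClass (1 : G × G) = Set.range (antiDiagonal G) := by
  ext p
  constructor
  · rintro ⟨⟨x, y⟩, rfl⟩
    exact ⟨x * y⁻¹, by simp [antiDiagonal, twist]⟩
  · rintro ⟨z, rfl⟩
    exact ⟨(z, 1), by simp [antiDiagonal, twist]⟩

variable {E : Type*} [NormedAddCommGroup E] [NormedSpace ℝ E]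
  {H : Type*} [TopologicalSpace H] {I : ModelWithCorners ℝ E H}
  {G : Type*} [Group G] [TopologicalSpace G] [ChartedSpace H G] [LieGroup I ∞ G]

variable (I) in
theorem mdifferentiable_inv' : MDifferentiable I I (fun y : G ↦ y⁻¹) :=
  (contMDiff_inv I ∞).mdifferentiable (by simp)

theorem mfderiv_antiDiagonal_apply (q : G) (w : TangentSpace I q) :
    (mfderiv I (I.prod I) (antiDiagonal G) q w : E × E) =
      ((w : E), (mfderiv I I (fun y : G ↦ y⁻¹) q w : E)) := by
  have := mfderiv_prodMk (I := I) (I' := I) (I'' := I) (x := q)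
    mdifferentiableAt_id (mdifferentiable_inv' I q)
  have e : mfderiv I (I.prod I) (antiDiagonal G) q w = _ :=
    congrArg (fun T : E →L[ℝ] E × E ↦ T w) this
  refine e.trans ?_
  refine Prod.ext ?_ rfl
  exact congrArg (fun T : E →L[ℝ] E ↦ T w) (mfderiv_id (I := I) (x := q))

theorem mfderiv_comp_antiDiagonal_apply {μ : G × G → G} (hμ : MDifferentiable (I.prod I) I μ)
    (hμ1 : ∀ y, μ (y, y⁻¹) = 1) (q : G) (w : TangentSpace I q) :
    ((mfderiv I I (fun z ↦ μ (z, q⁻¹)) q w : E) + (mfderiv I I (fun z ↦ μ (q, z)) q⁻¹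
      (mfderiv I I (fun y : G ↦ y⁻¹) q w) : E) : E) = 0 := by
  have h1 : (mfderiv (I.prod I) I μ (antiDiagonal G q)
      (mfderiv I (I.prod I) (antiDiagonal G) q w) : E) = _ :=
    congrArg (fun v : E × E ↦ (mfderiv (I.prod I) I μ (antiDiagonal G q) v : E))
      (mfderiv_antiDiagonal_apply q w)
  have h2 := mfderiv_prod_eq_add_apply (p := (q, q⁻¹))
    (v := (((w : E), (mfderiv I I (fun y : G ↦ y⁻¹) q w : E)) : E × E)) (hμ (q, q⁻¹))
  have h3 := mfderiv_comp_apply q (hμ (antiDiagonal G q))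
    (mdifferentiableAt_id.prodMk (mdifferentiable_inv' I q)) w
  have e : μ ∘ antiDiagonal G = fun _ ↦ 1 := funext hμ1
  refine (h2.symm.trans h1.symm).trans (h3.symm.trans ?_)
  change (mfderiv I I (μ ∘ antiDiagonal G) q w : E) = 0
  rw [e, mfderiv_const]
  rfl

/-- The derivative of inversion exchanges left and right trivializations, up to sign. -/
theorem leftTrivialization_symm_mfderiv_inv (q : G) (w : TangentSpace I q) :
    (leftTrivialization I q⁻¹).symm (mfderiv I I (fun y : G ↦ y⁻¹) q w) =
      -(rightTrivialization I q).symm w := by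
  rw [leftTrivialization_symm_apply, rightTrivialization_symm_apply, inv_inv]
  exact eq_neg_of_add_eq_zero_right (mfderiv_comp_antiDiagonal_apply
    (μ := fun p : G × G ↦ p.1 * p.2) ((contMDiff_mul I ∞).mdifferentiable (by simp))
    mul_inv_cancel q w)

theorem rightTrivialization_symm_mfderiv_inv (q : G) (w : TangentSpace I q) :
    (rightTrivialization I q⁻¹).symm (mfderiv I I (fun y : G ↦ y⁻¹) q w) =
      -(leftTrivialization I q).symm w := by
  rw [leftTrivialization_symm_apply, rightTrivialization_symm_apply, inv_inv]
  exact eq_neg_of_add_eq_zero_right (mfderiv_comp_antiDiagonal_apply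
    (μ := fun p : G × G ↦ p.2 * p.1)
    ((contMDiff_snd.mul contMDiff_fst : ContMDiff (I.prod I) I ∞ _).mdifferentiable (by simp))
    inv_mul_cancel q w)

theorem leftTrivialization_prod_symm_apply (p : G × G) (v : TangentSpace (I.prod I) p) :
    (leftTrivialization (I.prod I) p).symm v =
      ((leftTrivialization I p.1).symm v.1, (leftTrivialization I p.2).symm v.2) := by
  rw [leftTrivialization_symm_apply]
  have := mfderiv_prodMap (p := p) (mdifferentiable_mul_left' I p.1⁻¹ p.1)
    (mdifferentiable_mul_left' I p.2⁻¹ p.2)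
  exact congrArg (fun T : E × E →L[ℝ] E × E ↦ T v) this

theorem rightTrivialization_prod_symm_apply (p : G × G) (v : TangentSpace (I.prod I) p) :
    (rightTrivialization (I.prod I) p).symm v =
      ((rightTrivialization I p.1).symm v.1, (rightTrivialization I p.2).symm v.2) := by
  rw [rightTrivialization_symm_apply]
  have := mfderiv_prodMap (p := p) (mdifferentiable_mul_right' I p.1⁻¹ p.1)
    (mdifferentiable_mul_right' I p.2⁻¹ p.2)
  exact congrArg (fun T : E × E →L[ℝ] E × E ↦ T v) this

theorem leftTrivialization_prod_apply (p : G × G) (v : E × E) :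
    (leftTrivialization (I.prod I) p v : E × E) =
      (((leftTrivialization I p.1 v.1 : TangentSpace I p.1) : E),
        ((leftTrivialization I p.2 v.2 : TangentSpace I p.2) : E)) := by
  refine (leftTrivialization (I.prod I) p).symm.injective ?_
  rw [ContinuousLinearEquiv.symm_apply_apply]
  refine Eq.trans ?_ (leftTrivialization_prod_symm_apply (I := I) p _).symm
  exact Prod.ext ((leftTrivialization I p.1).symm_apply_apply v.1).symm
    ((leftTrivialization I p.2).symm_apply_apply v.2).symm

theorem rightTrivialization_prod_apply (p : G × G) (v : E × E) :
    (rightTrivialization (I.prod I) p v : E × E) =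
      (((rightTrivialization I p.1 v.1 : TangentSpace I p.1) : E),
        ((rightTrivialization I p.2 v.2 : TangentSpace I p.2) : E)) := by
  refine (rightTrivialization (I.prod I) p).symm.injective ?_
  rw [ContinuousLinearEquiv.symm_apply_apply]
  refine Eq.trans ?_ (rightTrivialization_prod_symm_apply (I := I) p _).symm
  exact Prod.ext ((rightTrivialization I p.1).symm_apply_apply v.1).symm
    ((rightTrivialization I p.2).symm_apply_apply v.2).symm

theorem leftTrivialization_symm_mfderiv_antiDiagonal (q : G) (w : TangentSpace I q) :
    (leftTrivialization (I.prod I) (antiDiagonal G q)).symm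
        (mfderiv I (I.prod I) (antiDiagonal G) q w) =
      ((leftTrivialization I q).symm w, -(rightTrivialization I q).symm w) := by
  rw [leftTrivialization_prod_symm_apply]
  refine Prod.ext ?_ ?_
  · exact congrArg (fun v : E × E ↦ (leftTrivialization I q).symm v.1)
      (mfderiv_antiDiagonal_apply q w)
  · exact (congrArg (fun v : E × E ↦ (leftTrivialization I q⁻¹).symm v.2)
      (mfderiv_antiDiagonal_apply q w)).trans (leftTrivialization_symm_mfderiv_inv q w)

theorem rightTrivialization_symm_mfderiv_antiDiagonal (q : G) (w : TangentSpace I q) :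
    (rightTrivialization (I.prod I) (antiDiagonal G q)).symm
        (mfderiv I (I.prod I) (antiDiagonal G) q w) =
      ((rightTrivialization I q).symm w, -(leftTrivialization I q).symm w) := by
  rw [rightTrivialization_prod_symm_apply]
  refine Prod.ext ?_ ?_
  · exact congrArg (fun v : E × E ↦ (rightTrivialization I q).symm v.1)
      (mfderiv_antiDiagonal_apply q w)
  · exact (congrArg (fun v : E × E ↦ (rightTrivialization I q⁻¹).symm v.2)
      (mfderiv_antiDiagonal_apply q w)).trans (rightTrivialization_symm_mfderiv_inv q w)

variable (I G) in
theorem isSmoothEmbedding_antiDiagonal :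
    Manifold.IsSmoothEmbedding I (I.prod I) ∞ (antiDiagonal G) := by
  have : IsTopologicalGroup G := topologicalGroup_of_lieGroup I ∞
  refine ⟨⟨E, inferInstance, inferInstance, fun z ↦ ?_⟩, ?_⟩
  · let φ := chartAt H z
    let ψ : OpenPartialHomeomorph G H := (Homeomorph.inv G).toOpenPartialHomeomorph.trans φ
    have hφ : φ ∈ IsManifold.maximalAtlas I ∞ G := IsManifold.chart_mem_maximalAtlas z
    have hψ : ψ ∈ IsManifold.maximalAtlas I ∞ G := by
      refine ψ.mem_maximalAtlas_of_contMDiffOn ?_ ?_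
      · refine (contMDiffOn_of_mem_maximalAtlas hφ).comp (contMDiff_inv I ∞).contMDiffOn ?_
        intro y hy
        simpa [ψ] using hy
      · refine (contMDiff_inv I ∞).comp_contMDiffOn
          ((contMDiffOn_symm_of_mem_maximalAtlas hφ).mono ?_)
        intro y hy
        simpa [ψ] using hy
    refine Manifold.IsImmersionAtOfComplement.mk_of_charts
      (ContinuousLinearEquiv.skewProd (.refl ℝ E) (.refl ℝ E) (.id ℝ E)) φ (φ.prod ψ)
      (mem_chart_source H z) ?_ hφ (IsManifold.mem_maximalAtlas_prod hφ hψ) ?_ ?_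
    · simp [antiDiagonal, ψ, φ]
    · intro y hy
      simpa [antiDiagonal, ψ] using hy
    · intro u hu
      have hy : φ.extend I ((φ.extend I).symm u) = u := (φ.extend I).right_inv hu
      refine Prod.ext ?_ ?_
      · exact hy
      · change φ.extend I ((φ.extend I).symm u)⁻¹⁻¹ = 0 + u
        rw [inv_inv, hy, zero_add]
  · refine Topology.IsEmbedding.of_comp (by unfold antiDiagonal; fun_prop) continuous_fst ?_
    exact Topology.IsEmbedding.id

namespace PseudoRiemannianMetric

variable {g : PseudoRiemannianMetric I G}

theorem inner_mfderiv_inv (hg : g.IsBiInvariant) (q : G) (v w : TangentSpace I q) :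
    g.inner q⁻¹ (mfderiv I I (fun y : G ↦ y⁻¹) q v) (mfderiv I I (fun y : G ↦ y⁻¹) q w) =
      g.inner q v w := by
  have h (u : TangentSpace I q) : mfderiv I I (fun y : G ↦ y⁻¹) q u =
      leftTrivialization I q⁻¹ (-(rightTrivialization I q).symm u) := by
    rw [← leftTrivialization_symm_mfderiv_inv, ContinuousLinearEquiv.apply_symm_apply]
  rw [h v, h w, hg.inner_leftTrivialization, ← hg.inner_rightTrivialization q]
  simp

theorem prod_inner_apply [FiniteDimensional ℝ E] (p : G × G) (v w : TangentSpace (I.prod I) p) :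
    (g.prod g).inner p v w = g.inner p.1 v.1 w.1 + g.inner p.2 v.2 w.2 := by
  change g.pullback (I.prod I) Prod.fst p v w + g.pullback (I.prod I) Prod.snd p v w = _
  rw [pullback_apply, pullback_apply, mfderiv_fst, mfderiv_snd]
  rfl

theorem IsBiInvariant.prod [FiniteDimensional ℝ E] (hg : g.IsBiInvariant) :
    (g.prod g).IsBiInvariant := by
  refine ⟨fun a x ↦ ?_, fun a x ↦ ?_⟩ <;> ext v w
  · have h := mfderiv_prodMap (p := x) (mdifferentiable_mul_left' I a.1 x.1)
      (mdifferentiable_mul_left' I a.2 x.2)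
    have h' (v : TangentSpace (I.prod I) x) :
        (mfderiv (I.prod I) (I.prod I) (fun y ↦ a * y) x v : E × E) =
          (mfderiv I I (a.1 * ·) x.1 v.1, mfderiv I I (a.2 * ·) x.2 v.2) :=
      congrArg (fun T : E × E →L[ℝ] E × E ↦ T v) h
    rw [pullback_apply, prod_inner_apply, prod_inner_apply]
    exact (congrArg₂ (fun v w : E × E ↦
      g.inner (a.1 * x.1) v.1 w.1 + g.inner (a.2 * x.2) v.2 w.2) (h' v) (h' w)).trans
      (congrArg₂ (· + ·) (hg.inner_mfderiv_mul_left a.1 x.1 v.1 w.1)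
        (hg.inner_mfderiv_mul_left a.2 x.2 v.2 w.2))
  · have h := mfderiv_prodMap (p := x) (mdifferentiable_mul_right' I a.1 x.1)
      (mdifferentiable_mul_right' I a.2 x.2)
    have h' (v : TangentSpace (I.prod I) x) :
        (mfderiv (I.prod I) (I.prod I) (fun y ↦ y * a) x v : E × E) =
          (mfderiv I I (· * a.1) x.1 v.1, mfderiv I I (· * a.2) x.2 v.2) :=
      congrArg (fun T : E × E →L[ℝ] E × E ↦ T v) h
    rw [pullback_apply, prod_inner_apply, prod_inner_apply]
    exact (congrArg₂ (fun v w : E × E ↦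
      g.inner (x.1 * a.1) v.1 w.1 + g.inner (x.2 * a.2) v.2 w.2) (h' v) (h' w)).trans
      (congrArg₂ (· + ·) (hg.inner_mfderiv_mul_right a.1 x.1 v.1 w.1)
        (hg.inner_mfderiv_mul_right a.2 x.2 v.2 w.2))

/-- The metric `g ⊕ g` induces `2 g` on the anti-diagonal. -/
theorem IsBiInvariant.pullback_antiDiagonal [FiniteDimensional ℝ E] (hg : g.IsBiInvariant) (q : G)
    (v w : TangentSpace I q) :
    (g.prod g).pullback I (antiDiagonal G) q v w = 2 * g.inner q v w := by
  rw [pullback_apply, prod_inner_apply, two_mul]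
  refine (congrArg₂ (fun v w : E × E ↦ g.inner q v.1 w.1 + g.inner q⁻¹ v.2 w.2)
    (mfderiv_antiDiagonal_apply q v) (mfderiv_antiDiagonal_apply q w)).trans ?_
  exact congrArg _ (inner_mfderiv_inv hg q v w)

theorem IsBiInvariant.isNondegenerateEmbedding_antiDiagonal [FiniteDimensional ℝ E]
    (hg : g.IsBiInvariant) : (g.prod g).IsNondegenerateEmbedding I (antiDiagonal G) where
  isSmoothEmbedding := isSmoothEmbedding_antiDiagonal I G
  nondegenerate p u hu := by
    refine g.nondegenerate p u fun w ↦ ?_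
    have := hu w
    rw [hg.pullback_antiDiagonal] at this
    simpa using this

end PseudoRiemannianMetric

theorem flatConnection_antiDiagonal {Θ : ∀ x : G × G, (E × E) ≃L[ℝ] TangentSpace (I.prod I) x}
    {Θ₁ Θ₂ : ∀ x : G, E ≃L[ℝ] TangentSpace I x} (hΘ : IsParallelization Θ)
    (hΘ₁ : IsParallelization Θ₁) (hΘ₂ : IsParallelization Θ₂)
    (h : ∀ (q : G) (w : TangentSpace I q), (Θ (antiDiagonal G q)).symm
      (mfderiv I (I.prod I) (antiDiagonal G) q w) = ((Θ₁ q).symm w, -(Θ₂ q).symm w))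
    {p : G} (u : TangentSpace I p) {Y : ∀ q : G, TangentSpace I q}
    {Z : ∀ x : G × G, TangentSpace (I.prod I) x}
    (hY : MDifferentiableAt I I.tangent (fun q ↦ (⟨q, Y q⟩ : TangentBundle I G)) p)
    (hZ : MDifferentiableAt (I.prod I) (I.prod I).tangent
      (fun x ↦ (⟨x, Z x⟩ : TangentBundle (I.prod I) (G × G))) (antiDiagonal G p))
    (hYZ : ∀ᶠ q in 𝓝 p, Z (antiDiagonal G q) = mfderiv I (I.prod I) (antiDiagonal G) q (Y q)) :
    hΘ.flatConnection Z (antiDiagonal G p) (mfderiv I (I.prod I) (antiDiagonal G) p u) =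
      Θ (antiDiagonal G p) (mvfderiv I (fun q ↦ (Θ₁ q).symm (Y q)) p u,
        -mvfderiv I (fun q ↦ (Θ₂ q).symm (Y q)) p u) := by
  rw [IsParallelization.flatConnection_apply,
    ← mvfderiv_prodMk_neg (hΘ₁.mdifferentiableAt_coord hY) (hΘ₂.mdifferentiableAt_coord hY)]
  congr 1
  have h1 := mfderiv_comp_apply p (hΘ.mdifferentiableAt_coord hZ)
    ((mdifferentiableAt_id.prodMk (mdifferentiable_inv' I p)) :
      MDifferentiableAt I (I.prod I) (antiDiagonal G) p) u
  have h2 : ((fun x ↦ (Θ x).symm (Z x)) ∘ antiDiagonal G) =ᶠ[𝓝 p]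
      fun q ↦ ((Θ₁ q).symm (Y q), -(Θ₂ q).symm (Y q)) := by
    filter_upwards [hYZ] with q hq
    rw [Function.comp_apply, hq, h]
  refine h1.symm.trans ?_
  exact congrArg (fun T : E →L[ℝ] E × E ↦ T u) h2.mfderiv_eq

theorem leftTrivialization_add_rightTrivialization_antiDiagonal (p : G) (a b : E) :
    leftTrivialization (I.prod I) (antiDiagonal G p) (a, -b) +
        rightTrivialization (I.prod I) (antiDiagonal G p) (b, -a) =
      mfderiv I (I.prod I) (antiDiagonal G) p
        (leftTrivialization I p a + rightTrivialization I p b) := by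
  have ha : mfderiv I I (fun y : G ↦ y⁻¹) p (leftTrivialization I p a) =
      rightTrivialization I p⁻¹ (-a) := by
    rw [← ContinuousLinearEquiv.symm_apply_eq, rightTrivialization_symm_mfderiv_inv,
      ContinuousLinearEquiv.symm_apply_apply]
  have hb : mfderiv I I (fun y : G ↦ y⁻¹) p (rightTrivialization I p b) =
      leftTrivialization I p⁻¹ (-b) := by
    rw [← ContinuousLinearEquiv.symm_apply_eq, leftTrivialization_symm_mfderiv_inv,
      ContinuousLinearEquiv.symm_apply_apply]
  have h3 := mfderiv_antiDiagonal_apply p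
    (leftTrivialization I p a + rightTrivialization I p b)
  refine (congrArg₂ (fun v w : E × E ↦ v + w) (leftTrivialization_prod_apply (I := I) _ _)
    (rightTrivialization_prod_apply (I := I) _ _)).trans
    (Eq.trans ?_ h3.symm)
  refine Prod.ext rfl ?_
  have h := map_add (mfderiv I I (fun y : G ↦ y⁻¹) p) (leftTrivialization I p a)
    (rightTrivialization I p b)
  rw [ha, hb] at h
  exact (add_comm _ _).trans h.symm

namespace PseudoRiemannianMetric

variable {g : PseudoRiemannianMetric I G}

theorem IsBiInvariant.isTotallyGeodesic_antiDiagonal [FiniteDimensional ℝ E]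
    [I.Boundaryless] (hg : g.IsBiInvariant) : (g.prod g).IsTotallyGeodesic I (antiDiagonal G) := by
  intro cov hcov
  refine ⟨fun p u v w ↦ by simp, fun p u Y Z hY hZ hYZ ↦ ?_⟩
  have hY' := hY.mdifferentiableAt (by simp)
  have hZ' := hZ.mdifferentiableAt (by simp)
  have hL := isParallelization_leftTrivialization (I := I) (G := G)
  have hR := isParallelization_rightTrivialization (I := I) (G := G)
  rw [hcov.unique hg.prod.isLeviCivita_meanConnection hZ',
    IsParallelization.meanConnection_apply,
    flatConnection_antiDiagonal _ hL hR leftTrivialization_symm_mfderiv_antiDiagonal u hY' hZ' hYZ,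
    flatConnection_antiDiagonal _ hR hL rightTrivialization_symm_mfderiv_antiDiagonal u hY' hZ' hYZ,
    leftTrivialization_add_rightTrivialization_antiDiagonal, ← map_smul]
  exact ⟨_, (add_zero _).symm⟩

end PseudoRiemannianMetric

end AntiDiagonal

theorem mainTheorem3
    {E : Type*} [NormedAddCommGroup E] [NormedSpace ℝ E] [FiniteDimensional ℝ E]
    {H : Type*} [TopologicalSpace H] (I : ModelWithCorners ℝ E H) [I.Boundaryless]
    (G : Type*) [Group G] [TopologicalSpace G] [ChartedSpace H G] [LieGroup I ∞ G]
    (g : PseudoRiemannianMetric I G) (hg : g.IsBiInvariant) :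
    twistedConjClass (1 : G × G) = Set.range (antiDiagonal G) ∧
    (g.prod g).IsNondegenerateEmbedding I (antiDiagonal G) ∧
    (∃ cov, (g.prod g).IsLeviCivita cov) ∧
    (g.prod g).IsTotallyGeodesic I (antiDiagonal G) ∧
    (g.prod g).IsMinimal I (antiDiagonal G) :=
  ⟨twistedConjClass_one G, hg.isNondegenerateEmbedding_antiDiagonal,
    ⟨_, hg.prod.isLeviCivita_meanConnection⟩, hg.isTotallyGeodesic_antiDiagonal,
    fun cov hcov ↦ ⟨_, hg.isTotallyGeodesic_antiDiagonal cov hcov,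
      fun _ ↦ Finset.sum_eq_zero fun _ _ ↦ Finset.sum_eq_zero fun _ _ ↦ smul_zero _⟩⟩
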